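/- **Definitions.** Fix a jump probability $\varepsilon\in(0,1)$. Graphs are directed, without parallel edges; self-loops are allowed. If every vertex of an $n$-vertex graph $G=(V,E)$ has out-degree $\deg(u)\ge 1$, the PageRank vector $\pi$ of $G$ is the unique stationary probability distribution of the random walk with transition probabilities $M_{u,v}=\frac{\varepsilon}{n}+(1-\varepsilon)\frac{1}{\deg(u)}$ if $(u,v)\in E$ and $M_{u,v}=\frac{\varepsilon}{n}$ otherwise. A dynamic algorithm for $n$-vertex graphs receives edge updates one at a time and, after each of them, works for some number of steps before it receives the next one; in a step it reads one memory cell, performs an arbitrary computation on its internal state, and writes at most one memory cell (the cell-probe model, with cells of arbitrary size and an arbitrary initial memory content). It *explicitly maintains* a vector $\tilde\pi\in\mathbb{R}^n$ in which each entry $\tilde\pi_v$ is stored in its own fixed memory cell. It *maintains a factor-2 approximation of PageRank* along an update sequence if at every time (initially and after each update has been processed) at which all out-degrees of the current graph are at least $1$, one has $\tfrac12\pi_v<\tilde\pi_v\le 2\pi_v$ for all vertices $v$, where $\pi$ is the PageRank vector of the current graph. Its total time is the total number of steps. **Theorem.** For every $\varepsilon\in(0,1)$ there are sequences $\sigma_n$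 of $\Theta(n)$ distinct edges on $n$ vertices ($n\in\mathbb{N}$) with the following property. For every constant $\delta>0$ there are $c>0$ and $n_0$ such that for all $n\ge n_0$: 1. (incremental) every algorithm that explicitly maintains a factor-2 approximation of PageRank while the edges of $\sigma_n$ are inserted one by one, in order, into the initially empty graph on $n$ vertices takes total time at least $c\,n^{2-\delta}$, and hence amortized time at least $c\,n^{1-\delta}$ per update; 2. (decremental) the same bounds hold for every algorithm that explicitly maintains such an approximation while the edges of $\sigma_n$ are deleted one by one, in reverse order, from the graph on $n$ vertices that consists of all edges of $\sigma_n$. -/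

import Mathlib

open Filter Asymptotics
open scoped Matrix

namespace DynPageRank

/-! ### PageRank -/

/-- A directed graph on the vertex set `Fin n`, given by its set of edges; `(u, v)` is an edge from
`u` to `v`. Self-loops are allowed. -/
abbrev Graph (n : ℕ) : Type := Finset (Fin n × Fin n)

/-- The out-degree of `u` (a self-loop counts). -/
def outDeg {n : ℕ} (G : Graph n) (u : Fin n) : ℕ :=
  (Finset.univ.filter fun v : Fin n => (u, v) ∈ G).card

/-- The transition matrix of the walk that jumps to a uniformly random vertex with
probability `ε` and otherwise follows a uniformly random out-going edge. -/
noncomputable def transition {n : ℕ} (ε : ℝ) (G : Graph n) : Matrix (Fin n) (Fin n) ℝ :=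
  Matrix.of fun u v => if (u, v) ∈ G then ε / n + (1 - ε) * (1 / outDeg G u) else ε / n

/-- `π` is the PageRank vector of `G`: a probability distribution on the vertices that is
stationary for the walk. -/
def IsPageRank {n : ℕ} (ε : ℝ) (G : Graph n) (π : Fin n → ℝ) : Prop :=
  π ∈ stdSimplex ℝ (Fin n) ∧ π ᵥ* transition ε G = π

/-- Every vertex has an out-going edge, as is required for PageRank to be well defined. -/
def NoDangling {n : ℕ} (G : Graph n) : Prop := ∀ u : Fin n, 1 ≤ outDeg G u

/-- PageRank is well defined on graphs in which every vertex has an out-going edge. -/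
theorem existsUnique_isPageRank {n : ℕ} (hn : 0 < n) {ε : ℝ} (h0 : 0 < ε) (h1 : ε < 1) (G : Graph n)
    (hG : NoDangling G) : ∃! π : Fin n → ℝ, IsPageRank ε G π := by
  have hnR : (n : ℝ) ≠ 0 := by positivity
  set B : Matrix (Fin n) (Fin n) ℝ :=
    Matrix.of fun u v => if (u, v) ∈ G then (1 - ε) * (1 / (outDeg G u : ℝ)) else 0 with hB
  have hBnn : ∀ u v, 0 ≤ B u v := by
    intro u v
    simp only [hB, Matrix.of_apply]
    split_ifs
    · have : 0 < 1 - ε := by linarith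
      positivity
    · rfl
  have hrow : ∀ u, ∑ v, B u v = 1 - ε := by
    intro u
    have hd : (outDeg G u : ℝ) ≠ 0 := by
      have := hG u
      positivity
    simp only [hB, Matrix.of_apply]
    rw [← Finset.sum_filter, Finset.sum_const, nsmul_eq_mul]
    change (outDeg G u : ℝ) * _ = _
    field_simp
  have hT : ∀ u v, transition ε G u v = ε / n + B u v := by
    intro u v
    simp only [transition, hB, Matrix.of_apply]
    split_ifs <;> simp
  have hdet : (1 - B).det ≠ 0 := by
    apply det_ne_zero_of_sum_row_lt_diag
    intro k
    have h2 : ∑ j ∈ Finset.univ.erase k, ‖(1 - B) k j‖ = ∑ j ∈ Finset.univ.erase k, B k j := by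
      refine Finset.sum_congr rfl fun j hj => ?_
      have : k ≠ j := (Finset.ne_of_mem_erase hj).symm
      simp [Matrix.sub_apply, Matrix.one_apply_ne this, abs_of_nonneg (hBnn k j)]
    have h3 := Finset.add_sum_erase Finset.univ (B k) (Finset.mem_univ k)
    rw [hrow] at h3
    rw [h2, Matrix.sub_apply, Matrix.one_apply_eq, Real.norm_eq_abs]
    have := le_abs_self (1 - B k k)
    linarith
  have hU : IsUnit (1 - B).det := isUnit_iff_ne_zero.mpr hdet
  have key : ∀ π : Fin n → ℝ, ∑ u, π u = 1 →
      (π ᵥ* transition ε G = π ↔ π ᵥ* (1 - B) = fun _ => ε / n) := by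
    intro π hs
    have : π ᵥ* transition ε G = (fun _ => ε / n) + π ᵥ* B := by
      ext v
      simp only [Matrix.vecMul, dotProduct, hT, mul_add, Finset.sum_add_distrib, Pi.add_apply,
        ← Finset.sum_mul, hs, one_mul]
    rw [this, Matrix.vecMul_sub, Matrix.vecMul_one, sub_eq_iff_eq_add, eq_comm]
  have colsum : ∀ π : Fin n → ℝ, ∑ v, ∑ u, π u * B u v = (1 - ε) * ∑ u, π u := by
    intro π
    rw [Finset.sum_comm]
    simp_rw [← Finset.mul_sum, hrow]
    rw [← Finset.sum_mul, mul_comm]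
  refine ⟨(fun _ => ε / n) ᵥ* (1 - B)⁻¹, ?_, ?_⟩
  · set π : Fin n → ℝ := (fun _ => ε / n) ᵥ* (1 - B)⁻¹ with hπ
    have e1 : π ᵥ* (1 - B) = fun _ => ε / n := by
      rw [hπ, Matrix.vecMul_vecMul, Matrix.nonsing_inv_mul _ hU, Matrix.vecMul_one]
    have e2 : ∀ v, π v = ε / n + ∑ u, π u * B u v := by
      intro v
      have := congrFun e1 v
      rw [Matrix.vecMul_sub, Matrix.vecMul_one] at this
      simp only [Pi.sub_apply, Matrix.vecMul, dotProduct] at this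
      linarith
    have hs : ∑ v, π v = 1 := by
      have : ∑ v, π v = ∑ v, (ε / n + ∑ u, π u * B u v) := Finset.sum_congr rfl fun v _ => e2 v
      rw [Finset.sum_add_distrib, colsum] at this
      simp at this
      field_simp at this
      nlinarith
    have ha : ∑ v, |π v| ≤ 1 := by
      have : ∑ v, |π v| ≤ ∑ v, (ε / n + ∑ u, |π u| * B u v) := by
        refine Finset.sum_le_sum fun v _ => ?_
        conv_lhs => rw [e2 v]
        refine (abs_add_le _ _).trans (add_le_add (by rw [abs_of_nonneg]; positivity) ?_)
        refine (Finset.abs_sum_le_sum_abs _ _).trans (Finset.sum_le_sum fun u _ => ?_)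
        rw [abs_mul, abs_of_nonneg (hBnn u v)]
      rw [Finset.sum_add_distrib, colsum (fun u => |π u|)] at this
      simp at this
      field_simp at this
      nlinarith
    have hnn : ∀ v, 0 ≤ π v := by
      by_contra! hc
      obtain ⟨v, hv⟩ := hc
      have : ∑ v, π v < ∑ v, |π v| :=
        Finset.sum_lt_sum (fun u _ => le_abs_self _) ⟨v, Finset.mem_univ _, by
          have := abs_nonneg (π v); linarith⟩
      linarith
    exact ⟨⟨hnn, hs⟩, (key π hs).2 e1⟩
  · rintro ρ ⟨⟨_, hs⟩, h⟩
    have := (key ρ hs).1 h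
    rw [← this, Matrix.vecMul_vecMul, Matrix.mul_nonsing_inv _ hU, Matrix.vecMul_one]

/-! ### Updates -/

/-- A single update of a dynamic graph. -/
inductive EdgeUpdate (n : ℕ) : Type
  | insert (e : Fin n × Fin n) : EdgeUpdate n
  | delete (e : Fin n × Fin n) : EdgeUpdate n

/-- The effect of an update on the graph. -/
def EdgeUpdate.apply {n : ℕ} (G : Graph n) : EdgeUpdate n → Graph n
  | .insert e => Insert.insert e G
  | .delete e => Finset.erase G e

/-- The graph obtained from `G` by a list of updates, performed from left to right. -/
def graphAfter {n : ℕ} (G : Graph n) (us : List (EdgeUpdate n)) : Graph n :=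
  us.foldl EdgeUpdate.apply G

/-! ### Algorithms and their running time -/

/-- A dynamic algorithm for `n`-vertex graphs that explicitly maintains a vector, in the cell-probe
model. The memory consists of cells numbered by `ℕ`, each holding a word; cell `v < n` holds the
`v`-th entry of the maintained vector. An update is handed over to the control unit. Then, in each
step, the machine reads one cell, changes its control state and writes at most one cell,
until it is done with the update. The control unit, the words and the computation on them are
unrestricted, and so is the initial content of the memory; a word RAM or real RAM program, with any
fixed outcome of its coin tosses, is a special case (up to a constant factor in the number of
steps). -/
structure Machine (n : ℕ) where
  Word : Type
  /-- The number that a word represents. -/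
  value : Word → ℝ
  Ctrl : Type
  initCtrl : Ctrl
  initMem : ℕ → Word
  /-- The effect on the control unit of handing over an update. -/
  receive : EdgeUpdate n → Ctrl → Ctrl
  /-- The address of the cell that is read next. -/
  probe : Ctrl → ℕ
  /-- The next control state and the write operation, if any, given the word just read; `none` means
  that the processing of the current update is complete. -/
  next : Ctrl → Word → Option (Ctrl × Option (ℕ × Word))

namespace Machine

variable {n : ℕ}

/-- A configuration: the control state and the content of the memory. -/
structure Config (A : Machine n) where
  ctrl : A.Ctrl
  mem : ℕ → A.Word

/-- The initial configuration. -/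
def init (A : Machine n) : A.Config := ⟨A.initCtrl, A.initMem⟩

/-- The configuration after an update has been handed over. -/
def feed (A : Machine n) (u : EdgeUpdate n) (c : A.Config) : A.Config :=
  ⟨A.receive u c.ctrl, c.mem⟩

/-- Perform a write operation, if there is one. -/
def write (A : Machine n) (mem : ℕ → A.Word) : Option (ℕ × A.Word) → ℕ → A.Word
  | none => mem
  | some (a, w) => Function.update mem a w

/-- One step of the machine; `none` if the processing of the current update is complete. -/
def step (A : Machine n) (c : A.Config) : Option A.Config :=
  (A.next c.ctrl (c.mem (A.probe c.ctrl))).map fun r => ⟨r.1, A.write c.mem r.2⟩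

/-- `A.Halts c t c'`: started in `c`, the machine performs exactly `t` steps, and is then done,
in configuration `c'`. -/
inductive Halts (A : Machine n) : A.Config → ℕ → A.Config → Prop
  | done {c : A.Config} (h : A.step c = none) : Halts A c 0 c
  | more {c c₁ c₂ : A.Config} {t : ℕ} (h : A.step c = some c₁) (h' : Halts A c₁ t c₂) :
      Halts A c (t + 1) c₂

/-- The vector stored in the memory. -/
def vector (A : Machine n) (c : A.Config) (v : Fin n) : ℝ := A.value (c.mem v)

/-- The execution of a machine on a list of updates: `conf k` is the configuration after the first
`k` updates have been processed, and `time k` is the number of steps spent on the next one. There is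
at most one execution up to irrelevant values at large indices, and there is none if the machine
fails to finish the processing of some update. -/
structure Execution (A : Machine n) (us : List (EdgeUpdate n)) where
  conf : ℕ → A.Config
  time : ℕ → ℕ
  start : conf 0 = A.init
  process : ∀ (k : ℕ) (hk : k < us.length), A.Halts (A.feed us[k] (conf k)) (time k) (conf (k + 1))

/-- The total running time on the list of updates. -/
def Execution.totalTime {A : Machine n} {us : List (EdgeUpdate n)} (x : A.Execution us) : ℕ :=
  ∑ k ∈ Finset.range us.length, x.time k

/-- At every point of time (initially and after each update) at which PageRank is defined, the
stored vector approximates the PageRank vector `π` of the current graph: `π v / 2 < π̃ v ≤ 2 π v`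
for all vertices `v`. The graph is `G` initially. -/
def Execution.Maintains {A : Machine n} {us : List (EdgeUpdate n)} (x : A.Execution us) (ε : ℝ)
    (G : Graph n) : Prop :=
  ∀ k ≤ us.length, NoDangling (graphAfter G (us.take k)) →
    ∀ π : Fin n → ℝ, IsPageRank ε (graphAfter G (us.take k)) π →
      ∀ v : Fin n, π v / 2 < A.vector (x.conf k) v ∧ A.vector (x.conf k) v ≤ 2 * π v

end Machine

/-- For the initial graphs `G n` and the update lists `us n` (both on `n` vertices), each machine that
maintains the approximation along the way needs total time `Ω(n ^ (2 - δ))`, and amortized time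
`Ω(n ^ (1 - δ))` per update. The constant `c` is the same for all machines. -/
def RequiresTime (ε δ : ℝ) (G : (n : ℕ) → Graph n) (us : (n : ℕ) → List (EdgeUpdate n)) : Prop :=
  ∃ c : ℝ, 0 < c ∧ ∀ᶠ n : ℕ in atTop,
    ∀ (A : Machine n) (x : A.Execution (us n)), x.Maintains ε (G n) →
      c * (n : ℝ) ^ (2 - δ) ≤ (x.totalTime : ℝ) ∧
      c * (n : ℝ) ^ (1 - δ) ≤ (x.totalTime : ℝ) / ((us n).length : ℝ)

end DynPageRank

/-! A step writes at most one cell. If the PageRanks of `N` vertices all change by a factor of at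
least 4, the ranges allowed for their stored values become disjoint, so at least `N` steps are spent
in between. It therefore suffices to build, by insertions only, a graph with `O(n)` edges in which
almost linearly many leaves fluctuate almost linearly often (`Fluctuates`). Deletions run through
the same graphs backwards.

In the instance, at least `n / 2` sources feed the root of a `D`-ary tree with `D ^ h` bottom nodes.
Each child is attached through twice as many parallel routes as the sibling before it, so the newest
child receives at least half of its parent's out-edges. Mass is thereby steered to bottom node `T`
without deleting anything, losing a factor of at most `2 / (1 - ε) ^ 2` per level
(`Edge.le_stationary_node`). At time `2 * T` that node is joined to a hub feeding `N` leaves, whose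
PageRank becomes at least `8 * ε / n` (`Edge.le_stationary_leaf`). At time `2 * T + 1` it gains `W`
edges to sources, which dilute the flow into the hub, and the leaves fall to at most `2 * ε / n`
(`Edge.stationary_leaf_le`).

The loss along the tree, at most `B ^ h` for a constant `B`, limits both `N` and `D ^ h` to about `n
/ B ^ h`. For `D = B ^ d` with `d` large this is only a small power of `n`
(`eventually_exists_isHard`). `hardList` then removes the dependence on the exponent. -/

namespace DynPageRank

/-! ### Changed memory cells as a lower bound on running time -/

namespace Machine

variable {n : ℕ} {A : Machine n}

theorem card_filter_write_ne_le (S : Finset ℕ) (mem : ℕ → A.Word) (w : Option (ℕ × A.Word)) :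
    {a | a ∈ S ∧ mem a ≠ A.write mem w a}.ncard ≤ 1 := by
  rcases w with _ | ⟨b, w⟩
  · simp [write]
  · refine (Set.ncard_le_ncard (t := {b}) ?_ (Set.finite_singleton b)).trans (by simp)
    rintro a ⟨-, ha⟩
    by_contra hab
    exact ha (by simp [write, Function.update_of_ne hab])

/-- A computation of `t` steps changes at most `t` cells. -/
theorem Halts.ncard_ne_le {c c' : A.Config} {t : ℕ} (h : A.Halts c t c') (S : Finset ℕ) :
    {a | a ∈ S ∧ c.mem a ≠ c'.mem a}.ncard ≤ t := by
  induction h with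
  | done _ => simp
  | @more c c₁ c₂ t h _ ih =>
    obtain ⟨r, -, rfl⟩ := Option.map_eq_some_iff.1 h
    have hfin : ∀ p : ℕ → Prop, {a | a ∈ S ∧ p a}.Finite := fun p =>
      S.finite_toSet.subset fun a ha => ha.1
    refine (Set.ncard_le_ncard (t := {a | a ∈ S ∧ c.mem a ≠ A.write c.mem r.2 a} ∪
      {a | a ∈ S ∧ A.write c.mem r.2 a ≠ c₂.mem a}) ?_ ((hfin _).union (hfin _))).trans ?_
    · rintro a ⟨haS, ha⟩
      by_cases h' : c.mem a = A.write c.mem r.2 a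
      · exact Or.inr ⟨haS, fun h'' => ha (h'.trans h'')⟩
      · exact Or.inl ⟨haS, h'⟩
    · refine (Set.ncard_union_le _ _).trans ?_
      rw [add_comm t]
      exact add_le_add (card_filter_write_ne_le S c.mem r.2) ih

namespace Execution

variable {us : List (EdgeUpdate n)}

/-- Handing over an update does not touch the memory, so only steps change cells, and a cell that
differs at the two ends was changed during some update. -/
theorem ncard_ne_le (x : A.Execution us) (S : Finset ℕ) {i j : ℕ} (hij : i ≤ j)
    (hj : j ≤ us.length) :
    {a | a ∈ S ∧ (x.conf i).mem a ≠ (x.conf j).mem a}.ncard ≤ ∑ k ∈ Finset.Ico i j, x.time k := by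
  induction j, hij using Nat.le_induction with
  | base => simp
  | succ j hij ih =>
    have hfin : ∀ p : ℕ → Prop, {a | a ∈ S ∧ p a}.Finite := fun p =>
      S.finite_toSet.subset fun a ha => ha.1
    have h1 := ih (by omega)
    have h2 := (x.process j (by omega)).ncard_ne_le S
    rw [Finset.sum_Ico_succ_top hij]
    refine (Set.ncard_le_ncard (t := {a | a ∈ S ∧ (x.conf i).mem a ≠ (x.conf j).mem a} ∪
      {a | a ∈ S ∧ (x.conf j).mem a ≠ (x.conf (j + 1)).mem a}) ?_ ((hfin _).union (hfin _))).trans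
      ((Set.ncard_union_le _ _).trans (add_le_add h1 h2))
    rintro a ⟨haS, ha⟩
    by_cases h' : (x.conf i).mem a = (x.conf j).mem a
    · exact Or.inr ⟨haS, fun h'' => ha (h'.trans h'')⟩
    · exact Or.inl ⟨haS, h'⟩

/-- If the stored values of all vertices in `L` change between two points of time, at least `#L`
steps are performed in between. -/
theorem card_le_sum_time (x : A.Execution us) (L : Finset (Fin n)) {i j : ℕ} (hij : i ≤ j)
    (hj : j ≤ us.length) (h : ∀ v ∈ L, A.vector (x.conf i) v ≠ A.vector (x.conf j) v) :
    L.card ≤ ∑ k ∈ Finset.Ico i j, x.time k := by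
  have h1 := x.ncard_ne_le (L.map Fin.valEmbedding) hij hj
  rw [← L.card_map Fin.valEmbedding, ← Set.ncard_coe_finset]
  refine (Set.ncard_le_ncard ?_ ((Finset.finite_toSet _).subset fun a ha => ha.1)).trans h1
  intro a ha
  refine ⟨ha, ?_⟩
  obtain ⟨v, hv, rfl⟩ := Finset.mem_map.1 ha
  exact fun hne => h v hv (congrArg A.value hne)

/-- The periods between consecutive checkpoints are disjoint, so their costs add up. -/
theorem mul_card_le_totalTime (x : A.Execution us) (L : Finset (Fin n)) (m : ℕ) (p : ℕ → ℕ)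
    (hp : ∀ k < m, p k ≤ p (k + 1)) (hlen : ∀ k ≤ m, p k ≤ us.length)
    (h : ∀ k < m, ∀ v ∈ L, A.vector (x.conf (p k)) v ≠ A.vector (x.conf (p (k + 1))) v) :
    m * L.card ≤ x.totalTime := by
  have key : ∀ k ≤ m, p 0 ≤ p k ∧ k * L.card ≤ ∑ i ∈ Finset.Ico (p 0) (p k), x.time i := by
    intro k
    induction k with
    | zero => simp
    | succ k ih =>
      intro hk
      obtain ⟨h0, h1⟩ := ih (by omega)
      refine ⟨h0.trans (hp k hk), ?_⟩
      rw [← Finset.sum_Ico_consecutive _ h0 (hp k hk), Nat.succ_mul]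
      exact add_le_add h1 (x.card_le_sum_time L (hp k hk) (hlen _ hk) (h k hk))
  refine (key m le_rfl).2.trans (Finset.sum_le_sum_of_subset fun i hi => ?_)
  have := hlen m le_rfl
  simp only [Finset.mem_Ico, Finset.mem_range] at hi ⊢
  omega

end Execution

end Machine

/-! ### Fluctuations of PageRank along a list of edges -/

variable {n : ℕ}

/-- The PageRanks of all vertices in `L` differ by a factor of at least `4` between `G` and `H`. -/
def FarApart (ε : ℝ) (L : Finset (Fin n)) (G H : Graph n) : Prop :=
  ∀ π ρ : Fin n → ℝ, IsPageRank ε G π → IsPageRank ε H ρ →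
    ∀ v ∈ L, 4 * π v ≤ ρ v ∨ 4 * ρ v ≤ π v

theorem FarApart.symm {ε : ℝ} {L : Finset (Fin n)} {G H : Graph n} (h : FarApart ε L G H) :
    FarApart ε L H G := fun π ρ hπ hρ v hv => (h ρ π hρ hπ v hv).symm

/-- The ranges `(π v / 2, 2 * π v]` and `(ρ v / 2, 2 * ρ v]` are disjoint at ratio 4 already,
because the lower bounds are strict; hence the stored value has to change. -/
theorem Machine.Execution.mul_card_le_totalTime_of_farApart (hn : 0 < n) {ε : ℝ} (h0 : 0 < ε)
    (h1 : ε < 1) {A : Machine n} {us : List (EdgeUpdate n)} (x : A.Execution us) {G : Graph n}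
    (hx : x.Maintains ε G) (L : Finset (Fin n)) (m : ℕ) (p : ℕ → ℕ)
    (hp : ∀ k < m, p k ≤ p (k + 1)) (hlen : ∀ k ≤ m, p k ≤ us.length)
    (hG : ∀ k ≤ m, NoDangling (graphAfter G (us.take (p k))))
    (h : ∀ k < m, FarApart ε L (graphAfter G (us.take (p k)))
      (graphAfter G (us.take (p (k + 1))))) :
    m * L.card ≤ x.totalTime := by
  refine x.mul_card_le_totalTime L m p hp hlen fun k hk v hv heq => ?_
  obtain ⟨π, hπ, -⟩ := existsUnique_isPageRank hn h0 h1 _ (hG k hk.le)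
  obtain ⟨ρ, hρ, -⟩ := existsUnique_isPageRank hn h0 h1 _ (hG (k + 1) hk)
  have a := hx _ (hlen k hk.le) (hG k hk.le) π hπ v
  have b := hx _ (hlen (k + 1) hk) (hG (k + 1) hk) ρ hρ v
  rw [heq] at a
  rcases h k hk π ρ hπ hρ v hv with h | h <;> linarith [a.1, a.2, b.1, b.2]

theorem graphAfter_map_insert (l : List (Fin n × Fin n)) (G : Graph n) :
    graphAfter G (l.map EdgeUpdate.insert) = G ∪ l.toFinset := by
  induction l generalizing G with
  | nil => simp [graphAfter]
  | cons e l ih =>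
    have := ih (insert e G)
    simp only [graphAfter, List.map_cons, List.foldl_cons, EdgeUpdate.apply] at this ⊢
    rw [this]
    ext
    simp

theorem graphAfter_map_delete (l : List (Fin n × Fin n)) (G : Graph n) :
    graphAfter G (l.map EdgeUpdate.delete) = G \ l.toFinset := by
  induction l generalizing G with
  | nil => simp [graphAfter]
  | cons e l ih =>
    have := ih (G.erase e)
    simp only [graphAfter, List.map_cons, List.foldl_cons, EdgeUpdate.apply] at this ⊢
    rw [this]
    ext
    simp
    tauto

theorem graphAfter_take_insert (σ : List (Fin n × Fin n)) (k : ℕ) :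
    graphAfter ∅ ((σ.map EdgeUpdate.insert).take k) = (σ.take k).toFinset := by
  rw [← List.map_take, graphAfter_map_insert, Finset.empty_union]

/-- Without repetitions, deleting a suffix of the list cannot remove an edge of the remaining
prefix. -/
theorem graphAfter_take_delete {σ : List (Fin n × Fin n)} (hσ : σ.Nodup) {k : ℕ}
    (hk : k ≤ σ.length) :
    graphAfter σ.toFinset ((σ.reverse.map EdgeUpdate.delete).take (σ.length - k)) =
      (σ.take k).toFinset := by
  rw [← List.map_take, graphAfter_map_delete, List.take_reverse,
    Nat.sub_sub_self hk, List.toFinset_reverse]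
  conv_lhs => rw [← List.take_append_drop k σ]
  rw [← List.take_append_drop k σ] at hσ
  have := List.disjoint_of_nodup_append hσ
  ext e
  simp only [List.toFinset_append, Finset.mem_sdiff, Finset.mem_union, List.mem_toFinset]
  constructor
  · simp only [List.take_append_drop]
    rintro ⟨a | a, b⟩ <;> tauto
  · exact fun a => ⟨Or.inl a, by simpa using fun b => this a (by simpa using b)⟩

/-- Along `σ`, the PageRanks of `N` vertices change `m` times by a factor of at least `4`. -/
def Fluctuates (ε : ℝ) (N m : ℕ) (σ : List (Fin n × Fin n)) : Prop :=
  ∃ (L : Finset (Fin n)) (p : ℕ → ℕ), L.card = N ∧ Monotone p ∧ (∀ k, p k ≤ σ.length) ∧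
    (∀ k, NoDangling (σ.take (p k)).toFinset) ∧
    ∀ k < m, FarApart ε L (σ.take (p k)).toFinset (σ.take (p (k + 1))).toFinset

theorem Fluctuates.le_totalTime_insert (hn : 0 < n) {ε : ℝ} (h0 : 0 < ε) (h1 : ε < 1) {N m : ℕ}
    {σ : List (Fin n × Fin n)} (hσ : Fluctuates ε N m σ) {A : Machine n}
    (x : A.Execution (σ.map EdgeUpdate.insert)) (hx : x.Maintains ε ∅) :
    m * N ≤ x.totalTime := by
  obtain ⟨L, p, rfl, hp, hlen, hG, hfar⟩ := hσ
  refine x.mul_card_le_totalTime_of_farApart hn h0 h1 hx L m p (fun k _ => hp k.le_succ)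
    (fun k _ => by simpa using hlen k) (fun k _ => ?_) fun k hk => ?_
  · rw [graphAfter_take_insert]
    exact hG k
  · rw [graphAfter_take_insert, graphAfter_take_insert]
    exact hfar k hk

theorem Fluctuates.le_totalTime_delete (hn : 0 < n) {ε : ℝ} (h0 : 0 < ε) (h1 : ε < 1) {N m : ℕ}
    {σ : List (Fin n × Fin n)} (hσ : Fluctuates ε N m σ) (hnd : σ.Nodup) {A : Machine n}
    (x : A.Execution (σ.reverse.map EdgeUpdate.delete)) (hx : x.Maintains ε σ.toFinset) :
    m * N ≤ x.totalTime := by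
  obtain ⟨L, p, rfl, hp, hlen, hG, hfar⟩ := hσ
  -- Deletions pass the same checkpoints in reverse order, and `FarApart` is symmetric.
  refine x.mul_card_le_totalTime_of_farApart hn h0 h1 hx L m (fun k => σ.length - p (m - k))
    (fun k _ => Nat.sub_le_sub_left (hp (by omega)) _) (fun k _ => by simp) (fun k _ => ?_)
    fun k hk => ?_
  · rw [graphAfter_take_delete hnd (hlen _)]
    exact hG _
  · rw [graphAfter_take_delete hnd (hlen _), graphAfter_take_delete hnd (hlen _)]
    have := hfar (m - (k + 1)) (by omega)
    rw [show m - (k + 1) + 1 = m - k by omega] at this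
    exact this.symm

/-- A growing sequence of finite sets can be enumerated in such a way that each of its members is
an initial segment. -/
theorem exists_list_of_monotone {α : Type*} [DecidableEq α] (F : ℕ → Finset α) (hF : Monotone F)
    (m : ℕ) :
    ∃ σ : List α, σ.Nodup ∧ σ.length = (F m).card ∧
      ∀ k ≤ m, (σ.take (F k).card).toFinset = F k := by
  induction m with
  | zero => exact ⟨(F 0).toList, Finset.nodup_toList _, by simp, by
      intro k hk
      obtain rfl : k = 0 := by omega
      rw [List.take_of_length_le (by simp)]
      simp⟩
  | succ m ih =>
    obtain ⟨σ, h1, h2, h3⟩ := ih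
    have hm : σ.toFinset = F m := by
      have := h3 m le_rfl
      rwa [← h2, List.take_length] at this
    have hl : (σ ++ (F (m + 1) \ F m).toList).length = (F (m + 1)).card := by
      rw [List.length_append, h2, Finset.length_toList,
        Finset.card_sdiff_of_subset (hF m.le_succ)]
      exact Nat.add_sub_of_le (Finset.card_le_card (hF m.le_succ))
    refine ⟨σ ++ (F (m + 1) \ F m).toList, ?_, hl, ?_⟩
    · refine List.nodup_append'.2 ⟨h1, Finset.nodup_toList _, fun a ha hb => ?_⟩
      rw [← List.mem_toFinset, hm] at ha
      rw [Finset.mem_toList, Finset.mem_sdiff] at hb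
      exact hb.2 ha
    · intro k hk
      rcases Nat.lt_or_ge m k with h | h
      · obtain rfl : k = m + 1 := by omega
        rw [← hl, List.take_length, List.toFinset_append, hm, Finset.toList_toFinset,
          Finset.union_sdiff_of_subset (hF m.le_succ)]
      · rw [List.take_append_of_le_length (by rw [h2]; exact Finset.card_le_card (hF h)), h3 k h]

theorem exists_fluctuates {ε : ℝ} (F : ℕ → Graph n) (hF : Monotone F) (m : ℕ) (L : Finset (Fin n))
    (hG : ∀ k, NoDangling (F k)) (h : ∀ k < m, FarApart ε L (F k) (F (k + 1))) :
    ∃ σ : List (Fin n × Fin n), σ.Nodup ∧ σ.length = (F m).card ∧ Fluctuates ε L.card m σ := by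
  obtain ⟨σ, h1, h2, h3⟩ := exists_list_of_monotone F hF m
  -- The checkpoints are frozen after `m`, since the list enumerates the graphs only up to `F m`.
  refine ⟨σ, h1, h2, L, fun k => (F (min k m)).card, rfl,
    fun i j hij => Finset.card_le_card (hF (min_le_min_right m hij)), fun k => ?_, fun k => ?_,
    fun k hk => ?_⟩
  · rw [h2]
    exact Finset.card_le_card (hF (min_le_right k m))
  · rw [h3 _ (min_le_right k m)]
    exact hG _
  · rw [h3 _ (min_le_right _ m), h3 _ (min_le_right _ m), min_eq_left hk.le, min_eq_left hk]
    exact h k hk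

/-! ### Balance equations and flow estimates on a general vertex type -/

section Stationary

open scoped Classical

variable {V : Type*} [Fintype V]

/-- The number of out-going edges of `u`. -/
noncomputable def relDeg (E : V → V → Prop) (u : V) : ℕ := (Finset.univ.filter (E u)).card

/-- The vector `ρ` is the PageRank of the relation `E`. -/
structure IsStationary (ε : ℝ) (E : V → V → Prop) (ρ : V → ℝ) : Prop where
  nonneg : ∀ v, 0 ≤ ρ v
  sum_eq : ∑ v, ρ v = 1
  apply_eq : ∀ v, ρ v = ε / Fintype.card V +
    ∑ u ∈ Finset.univ.filter (E · v), (1 - ε) / relDeg E u * ρ u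

/-- The graph on `Fin n` that corresponds to a relation. -/
noncomputable def graphOf {n : ℕ} (e : V ≃ Fin n) (E : V → V → Prop) : Graph n :=
  Finset.univ.filter fun p => E (e.symm p.1) (e.symm p.2)

variable {n : ℕ} (e : V ≃ Fin n) {E : V → V → Prop}

omit [Fintype V] in
theorem mem_graphOf {u v : V} : (e u, e v) ∈ graphOf e E ↔ E u v := by
  simp [graphOf]

theorem outDeg_graphOf (u : V) : outDeg (graphOf e E) (e u) = relDeg E u := by
  rw [outDeg, relDeg, ← Finset.card_map e.toEmbedding]
  congr 1
  ext v
  obtain ⟨w, rfl⟩ := e.surjective v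
  simp [mem_graphOf]

theorem noDangling_graphOf (h : ∀ u, ∃ v, E u v) : NoDangling (graphOf e E) := by
  intro u
  obtain ⟨u, rfl⟩ := e.surjective u
  rw [outDeg_graphOf]
  obtain ⟨v, hv⟩ := h u
  exact Finset.card_pos.2 ⟨v, by simpa using hv⟩

theorem IsPageRank.isStationary {ε : ℝ} {π : Fin n → ℝ} (h : IsPageRank ε (graphOf e E) π) :
    IsStationary ε E (π ∘ e) := by
  have hs : ∑ v, π (e v) = 1 := (e.sum_comp π).trans h.1.2
  refine ⟨fun v => h.1.1 _, hs, fun v => ?_⟩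
  have h2 := congrFun h.2 (e v)
  rw [Matrix.vecMul, dotProduct, ← e.sum_comp] at h2
  rw [Function.comp_apply, ← h2, Finset.sum_filter, Fintype.card_congr e, Fintype.card_fin]
  have : ∀ u, π (e u) * transition ε (graphOf e E) (e u) (e v) =
      π (e u) * (ε / n) + if E u v then (1 - ε) / relDeg E u * π (e u) else 0 := by
    intro u
    simp only [transition, Matrix.of_apply, mem_graphOf, outDeg_graphOf]
    split_ifs <;> ring
  simp only [this, Finset.sum_add_distrib, ← Finset.sum_mul, hs, one_mul, Function.comp_apply]

theorem farApart_graphOf {ε : ℝ} {E E' : V → V → Prop} (L : Finset V)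
    (h : ∀ ρ ρ' : V → ℝ, IsStationary ε E ρ → IsStationary ε E' ρ' →
      ∀ v ∈ L, 4 * ρ v ≤ ρ' v ∨ 4 * ρ' v ≤ ρ v) :
    FarApart ε (L.map e.toEmbedding) (graphOf e E) (graphOf e E') := by
  intro π π' hπ hπ' v hv
  obtain ⟨w, hw, rfl⟩ := Finset.mem_map.1 hv
  exact h _ _ (hπ.isStationary e) (hπ'.isStationary e) w hw

namespace IsStationary

variable {ε : ℝ} {ρ : V → ℝ} (h : IsStationary ε E ρ) (h0 : 0 < ε) (h1 : ε < 1)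

include h h1

theorem flow_nonneg (u : V) : 0 ≤ (1 - ε) / relDeg E u * ρ u :=
  mul_nonneg (div_nonneg (by linarith) (by positivity)) (h.nonneg u)

theorem jump_le (v : V) : ε / Fintype.card V ≤ ρ v := by
  rw [h.apply_eq v]
  exact le_add_of_nonneg_right (Finset.sum_nonneg fun u _ => h.flow_nonneg h1 u)

include h0

theorem sum_flow_le (v : V) (S : Finset V) (hS : ∀ u ∈ S, E u v) :
    ∑ u ∈ S, (1 - ε) / relDeg E u * ρ u ≤ ρ v := by
  rw [h.apply_eq v]
  refine (Finset.sum_le_sum_of_subset_of_nonneg (fun u hu => ?_) fun u _ _ =>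
    h.flow_nonneg h1 u).trans (le_add_of_nonneg_left (by positivity))
  simpa using hS u hu

theorem flow_le {u v : V} (huv : E u v) : (1 - ε) / relDeg E u * ρ u ≤ ρ v := by
  simpa using h.sum_flow_le h0 h1 v {u} (by simpa using huv)

omit h0 in
-- The in-neighbours have total mass at most 1, and each passes on at most a fraction `(1 - ε) / W`
-- of its own. This is the dilution used at odd times.
theorem le_of_forall_le_relDeg {W : ℕ} (hW : 0 < W) (v : V) (hv : ∀ u, E u v → W ≤ relDeg E u) :
    ρ v ≤ ε / Fintype.card V + 1 / W * (1 - ε) := by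
  rw [h.apply_eq v]
  have hW' : (0 : ℝ) < W := by exact_mod_cast hW
  have hs : ∑ u ∈ Finset.univ.filter (E · v), ρ u ≤ 1 := by
    rw [← h.sum_eq]
    exact Finset.sum_le_sum_of_subset_of_nonneg (Finset.subset_univ _) fun u _ _ => h.nonneg u
  have : ∑ u ∈ Finset.univ.filter (E · v), (1 - ε) / relDeg E u * ρ u ≤
      ∑ u ∈ Finset.univ.filter (E · v), (1 - ε) / W * ρ u := by
    refine Finset.sum_le_sum fun u hu => mul_le_mul_of_nonneg_right ?_ (h.nonneg u)
    refine div_le_div_of_nonneg_left (by linarith) hW' ?_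
    exact_mod_cast hv u (by simpa using hu)
  rw [← Finset.mul_sum] at this
  have h3 : (1 - ε) / W * ∑ u ∈ Finset.univ.filter (E · v), ρ u ≤ (1 - ε) / W * 1 :=
    mul_le_mul_of_nonneg_left hs (div_nonneg (by linarith) hW'.le)
  have : (1 - ε) / W * 1 = 1 / W * (1 - ε) := by ring
  linarith

omit h0 h1 in
theorem eq_of_forall_iff {v t : V} (hv : ∀ u, E u v ↔ u = t) :
    ρ v = ε / Fintype.card V + (1 - ε) / relDeg E t * ρ t := by
  rw [h.apply_eq v]
  simp [hv, Finset.sum_filter]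

/-- At least half of what leaves `x` arrives in `y` if at least half of the edges out of `x` lead
to vertices whose only edge leads to `y`. -/
theorem two_step_le {x y : V} (Z : Finset V) (hZ : Z.Nonempty) (hx : ∀ z ∈ Z, E x z)
    (hy : ∀ z ∈ Z, E z y) (hdeg : ∀ z ∈ Z, relDeg E z = 1) (hxd : relDeg E x ≤ 2 * Z.card) :
    (1 - ε) ^ 2 / 2 * ρ x ≤ ρ y := by
  have hε : 0 < 1 - ε := by linarith
  have hZc : (0 : ℝ) < Z.card := by exact_mod_cast hZ.card_pos
  have hxd' : (relDeg E x : ℝ) ≤ 2 * Z.card := by exact_mod_cast hxd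
  have hx0 : (0 : ℝ) < relDeg E x := by
    obtain ⟨z, hz⟩ := hZ
    exact_mod_cast Finset.card_pos.2 ⟨z, by simpa using hx z hz⟩
  refine le_trans ?_ (h.sum_flow_le h0 h1 y Z hy)
  have h2 : ∑ z ∈ Z, (1 - ε) * ((1 - ε) / relDeg E x * ρ x) ≤
      ∑ z ∈ Z, (1 - ε) / relDeg E z * ρ z := by
    refine Finset.sum_le_sum fun z hz => ?_
    rw [hdeg z hz, Nat.cast_one, div_one]
    exact mul_le_mul_of_nonneg_left (h.flow_le h0 h1 (hx z hz)) hε.le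
  refine le_trans ?_ h2
  rw [Finset.sum_const, nsmul_eq_mul]
  have h3 : 1 / 2 ≤ (Z.card : ℝ) / relDeg E x := by
    rw [div_le_div_iff₀ two_pos hx0]
    linarith
  calc (1 - ε) ^ 2 / 2 * ρ x = 1 / 2 * ((1 - ε) ^ 2 * ρ x) := by ring
    _ ≤ Z.card / relDeg E x * ((1 - ε) ^ 2 * ρ x) :=
      mul_le_mul_of_nonneg_right h3 (mul_nonneg (by positivity) (h.nonneg x))
    _ = _ := by ring

end IsStationary

end Stationary

/-! ### The hard instance: edges and degrees -/

/-- The vertices of the hard instance: a `D`-ary tree of height `h` with nodes `node l a` at height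
`l`, several parallel routes `mid l b c` into `node l b`, a hub that feeds `N` leaves, and `r`
sources. -/
inductive Vertex (N h M C r : ℕ) : Type
  | hub : Vertex N h M C r
  | leaf (i : Fin N) : Vertex N h M C r
  | node (l : Fin (h + 1)) (a : Fin M) : Vertex N h M C r
  | mid (l : Fin h) (b : Fin M) (c : Fin C) : Vertex N h M C r
  | source (j : Fin r) : Vertex N h M C r

namespace Vertex

variable {N h M C r : ℕ}

/-- The vertices as a disjoint union. -/
def equivSum : Vertex N h M C r ≃
    Unit ⊕ Fin N ⊕ (Fin (h + 1) × Fin M) ⊕ (Fin h × Fin M × Fin C) ⊕ Fin r where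
  toFun
    | hub => .inl ()
    | leaf i => .inr (.inl i)
    | node l a => .inr (.inr (.inl (l, a)))
    | mid l b c => .inr (.inr (.inr (.inl (l, b, c))))
    | source j => .inr (.inr (.inr (.inr j)))
  invFun
    | .inl () => hub
    | .inr (.inl i) => leaf i
    | .inr (.inr (.inl (l, a))) => node l a
    | .inr (.inr (.inr (.inl (l, b, c)))) => mid l b c
    | .inr (.inr (.inr (.inr j))) => source j
  left_inv v := by cases v <;> rfl
  right_inv v := by rcases v with _ | _ | _ | _ | _ <;> rfl

instance : Fintype (Vertex N h M C r) := Fintype.ofEquiv _ equivSum.symm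

theorem card_eq : Fintype.card (Vertex N h M C r) =
    1 + (N + ((h + 1) * M + (h * (M * C) + r))) := by
  rw [Fintype.card_congr equivSum]
  simp

end Vertex

open Vertex

/-- The edges of the hard instance at time `k`. Node `b` at height `l` is attached to its parent at
time `2 * (b * D ^ l)` by means of `2 ^ (b % D)` parallel routes. The node `a` at height `0` is
connected to the hub at time `2 * a`, and to `W` sources at time `2 * a + 1`. -/
inductive Edge (N h M D r W k : ℕ) : Vertex N h M (2 ^ D) r → Vertex N h M (2 ^ D) r → Prop
  | hubLeaf (i) : Edge N h M D r W k hub (leaf i)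
  | leafRoot (i) (l a) (hl : l.val = h) (ha : a.val = 0) : Edge N h M D r W k (leaf i) (node l a)
  | sourceRoot (j) (l a) (hl : l.val = h) (ha : a.val = 0) :
      Edge N h M D r W k (source j) (node l a)
  | nodeRoot (l' a') (l a) (hl : l.val = h) (ha : a.val = 0) :
      Edge N h M D r W k (node l' a') (node l a)
  | midNode (l b c) (l') (hl : l'.val = l.val) : Edge N h M D r W k (mid l b c) (node l' b)
  | nodeMid (l' a) (l b c) (hl : l'.val = l.val + 1) (hb : b.val / D = a.val) (hc : c.val ≠ 0)
      (hcb : Nat.log 2 c.val = b.val % D) (hk : 2 * (b.val * D ^ l.val) ≤ k) :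
      Edge N h M D r W k (node l' a) (mid l b c)
  | nodeHub (l a) (hl : l.val = 0) (hk : 2 * a.val ≤ k) : Edge N h M D r W k (node l a) hub
  | nodeSource (l a) (j) (hl : l.val = 0) (hk : 2 * a.val + 1 ≤ k) (hj : j.val < W) :
      Edge N h M D r W k (node l a) (source j)

namespace Edge

variable {N h M D r W : ℕ}

theorem mono {k k' : ℕ} (hk : k ≤ k') {u v : Vertex N h M (2 ^ D) r}
    (huv : Edge N h M D r W k u v) : Edge N h M D r W k' u v := by
  cases huv with
  | hubLeaf i => exact .hubLeaf i
  | leafRoot i l a hl ha => exact .leafRoot i l a hl ha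
  | sourceRoot j l a hl ha => exact .sourceRoot j l a hl ha
  | nodeRoot l' a' l a hl ha => exact .nodeRoot l' a' l a hl ha
  | midNode l b c l' hl => exact .midNode l b c l' hl
  | nodeMid l' a l b c hl hb hc hcb h' => exact .nodeMid l' a l b c hl hb hc hcb (h'.trans hk)
  | nodeHub l a hl h' => exact .nodeHub l a hl (h'.trans hk)
  | nodeSource l a j hl h' hj => exact .nodeSource l a j hl (h'.trans hk) hj

/-- The time-independent edges suffice; in particular, tree nodes not yet attached have their edge
to the root. -/
theorem exists_edge (hN : 0 < N) (hM : 0 < M) (k : ℕ) (u : Vertex N h M (2 ^ D) r) :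
    ∃ v, Edge N h M D r W k u v := by
  cases u with
  | hub => exact ⟨_, hubLeaf ⟨0, hN⟩⟩
  | leaf i => exact ⟨_, leafRoot i (Fin.last h) ⟨0, hM⟩ rfl rfl⟩
  | node l a => exact ⟨_, nodeRoot l a (Fin.last h) ⟨0, hM⟩ rfl rfl⟩
  | mid l b c => exact ⟨_, midNode l b c l.castSucc rfl⟩
  | source j => exact ⟨_, sourceRoot j (Fin.last h) ⟨0, hM⟩ rfl rfl⟩

open scoped Classical

variable {k : ℕ}

theorem relDeg_hub : relDeg (Edge N h M D r W k) hub = N := by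
  have : Finset.univ.filter (Edge N h M D r W k hub) =
      Finset.univ.map ⟨leaf, fun i j hij => by cases hij; rfl⟩ := by
    ext v
    simp only [Finset.mem_filter, Finset.mem_univ, true_and, Finset.mem_map]
    constructor
    · rintro ⟨⟩
      exact ⟨_, rfl⟩
    · rintro ⟨i, rfl⟩
      exact .hubLeaf i
  rw [relDeg, this, Finset.card_map, Finset.card_univ, Fintype.card_fin]

theorem relDeg_source (hM : 0 < M) (j : Fin r) :
    relDeg (Edge N h M D r W k) (source j) = 1 := by
  refine Finset.card_eq_one.2 ⟨node (Fin.last h) ⟨0, hM⟩, ?_⟩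
  ext v
  simp only [Finset.mem_filter, Finset.mem_univ, true_and, Finset.mem_singleton]
  constructor
  · rintro (_ | _ | ⟨_, l, a, hl, ha⟩)
    rw [show l = Fin.last h from Fin.ext hl, show a = ⟨0, hM⟩ from Fin.ext ha]
  · rintro rfl
    exact .sourceRoot _ _ _ rfl rfl

theorem relDeg_mid (l : Fin h) (b : Fin M) (c : Fin (2 ^ D)) :
    relDeg (Edge N h M D r W k) (mid l b c) = 1 := by
  refine Finset.card_eq_one.2 ⟨node l.castSucc b, ?_⟩
  ext v
  simp only [Finset.mem_filter, Finset.mem_univ, true_and, Finset.mem_singleton]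
  constructor
  · rintro (_ | _ | _ | _ | ⟨_, _, _, l', hl⟩)
    rw [show l' = l.castSucc from Fin.ext hl]
  · rintro rfl
    exact .midNode _ _ _ _ rfl

/-- At time `2 * T`, the node `T` at height `0` is not yet connected to any source. -/
theorem relDeg_node_zero_le {T : ℕ} (a : Fin M) (ha : a.val = T) :
    relDeg (Edge N h M D r W (2 * T)) (node 0 a) ≤ 2 := by
  have hM : 0 < M := by have := a.isLt; omega
  refine (Finset.card_le_card (t := {node (Fin.last h) ⟨0, hM⟩, hub}) fun v hv => ?_).trans
    Finset.card_le_two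
  simp only [Finset.mem_filter, Finset.mem_univ, true_and, Finset.mem_insert,
    Finset.mem_singleton] at hv ⊢
  rcases hv with _ | _ | _ | ⟨_, _, l, a', hl, ha'⟩ | _ | ⟨_, _, l, b, c, hl⟩ | _ | ⟨_, _, _, _, hk⟩
  · rw [show l = Fin.last h from Fin.ext hl, show a' = ⟨0, hM⟩ from Fin.ext ha']
    exact Or.inl rfl
  · simp at hl
  · exact Or.inr rfl
  · omega

/-- The vertices on the routes into `node l b`. -/
noncomputable def routes (N M r : ℕ) {h : ℕ} (D : ℕ) (l : Fin h) (b : Fin M) :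
    Finset (Vertex N h M (2 ^ D) r) :=
  (Finset.univ.filter fun c : Fin (2 ^ D) => c.val ≠ 0 ∧ Nat.log 2 c.val = b.val % D).image
    (mid l b)

theorem card_routes (hD : 0 < D) (l : Fin h) (b : Fin M) :
    (routes N M r D l b).card = 2 ^ (b.val % D) := by
  have hb : b.val % D + 1 ≤ D := Nat.mod_lt _ hD
  rw [routes, Finset.card_image_of_injective _ fun c c' hc => by cases hc; rfl]
  -- The labels of the routes form a dyadic block. Blocks of different siblings are disjoint and
  -- double in size.
  have : (Finset.univ.filter fun c : Fin (2 ^ D) => c.val ≠ 0 ∧ Nat.log 2 c.val = b.val % D).map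
      Fin.valEmbedding = Finset.Ico (2 ^ (b.val % D)) (2 ^ (b.val % D + 1)) := by
    ext c
    simp only [Finset.mem_map, Finset.mem_filter, Finset.mem_univ, true_and, Fin.valEmbedding_apply,
      Finset.mem_Ico]
    constructor
    · rintro ⟨c, ⟨hc, hcb⟩, rfl⟩
      rw [← hcb]
      exact ⟨Nat.pow_log_le_self 2 hc, Nat.lt_pow_succ_log_self one_lt_two _⟩
    · rintro ⟨h1, h2⟩
      refine ⟨⟨c, h2.trans_le (Nat.pow_le_pow_right two_pos hb)⟩, ⟨?_, ?_⟩, rfl⟩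
      · have := Nat.two_pow_pos (b.val % D)
        simp only
        omega
      · exact Nat.log_eq_of_pow_le_of_lt_pow h1 h2
  rw [← Finset.card_map Fin.valEmbedding, this, Nat.card_Ico, pow_succ]
  omega

/-- At time `2 * T`, at least half of the edges out of a node on the path to node `T` at height `0`
lead further along that path. -/
theorem relDeg_node_succ_le (hD : 0 < D) {T : ℕ} (l : Fin h) (a b : Fin M)
    (ha : a.val = T / D ^ (l.val + 1)) (hb : b.val = T / D ^ l.val) :
    relDeg (Edge N h M D r W (2 * T)) (node l.succ a) ≤ 2 * (routes N M r D l b).card := by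
  rw [card_routes hD, ← pow_succ', relDeg, ← Finset.card_range (2 ^ (b.val % D + 1))]
  have hab : b.val / D = a.val := by rw [ha, hb, pow_succ, Nat.div_div_eq_div_mul]
  -- A node is attached at the time of its leftmost descendant at height 0, so no sibling after `b`
  -- is present yet.
  have hT : ∀ b' : ℕ, 2 * (b' * D ^ l.val) ≤ 2 * T → b' ≤ b.val := by
    intro b' h'
    rw [hb, Nat.le_div_iff_mul_le (by positivity)]
    omega
  -- Out-neighbours are counted by route label. The dyadic blocks of all children up to `b` lie in
  -- `[1, 2 ^ (b % D + 1))`, and the excluded label 0 is free for the root.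
  refine Finset.card_le_card_of_injOn
    (fun v => match v with
      | mid _ _ c => c.val
      | _ => 0) ?_ ?_
  · intro v hv
    simp only [Finset.coe_filter, Finset.mem_univ, true_and, Set.mem_ofPred_eq] at hv
    simp only [Finset.coe_range, Set.mem_Iio]
    rcases hv with _ | _ | _ | _ | _ | ⟨_, _, l', b', c, hl, hb', hc, hcb, hk⟩ | ⟨_, _, hl⟩ |
      ⟨_, _, _, hl⟩
    · positivity
    · have hl' : l' = l := Fin.ext (by simpa using hl.symm)
      subst hl'
      have h1 := hT _ hk
      refine (Nat.lt_pow_succ_log_self one_lt_two _).trans_le (Nat.pow_le_pow_right two_pos ?_)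
      rw [hcb]
      have h2 := Nat.div_add_mod b'.val D
      have h3 := Nat.div_add_mod b.val D
      rw [hb'] at h2
      rw [hab] at h3
      show b'.val % D + 1 ≤ b.val % D + 1
      omega
    · simp at hl
    · simp at hl
  · intro v hv w hw hvw
    simp only [Finset.coe_filter, Finset.mem_univ, true_and, Set.mem_ofPred_eq] at hv hw
    rcases hv with _ | _ | _ | ⟨_, _, l', a', hl, ha'⟩ | _ | ⟨_, _, l', b', c, hl, hb', hc, hcb, -⟩ |
      ⟨_, _, hl⟩ | ⟨_, _, _, hl⟩
    · rcases hw with _ | _ | _ | ⟨_, _, l₂, a₂, hl₂, ha₂⟩ | _ |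
        ⟨_, _, l₂, b₂, c₂, hl₂, hb₂, hc₂, hcb₂, -⟩ | ⟨_, _, hl₂⟩ | ⟨_, _, _, hl₂⟩
      · rw [show l' = l₂ from Fin.ext (by omega), show a' = a₂ from Fin.ext (by omega)]
      · exact absurd hvw.symm hc₂
      · simp at hl₂
      · simp at hl₂
    · rcases hw with _ | _ | _ | ⟨_, _, l₂, a₂, hl₂, ha₂⟩ | _ |
        ⟨_, _, l₂, b₂, c₂, hl₂, hb₂, hc₂, hcb₂, -⟩ | ⟨_, _, hl₂⟩ | ⟨_, _, _, hl₂⟩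
      · exact absurd hvw hc
      · have hcc : c = c₂ := Fin.ext hvw
        have hll : l' = l₂ := Fin.ext (by omega)
        -- The common parent gives the quotient by `D`, the logarithm of the common label gives the
        -- remainder.
        have hbb : b' = b₂ := by
          refine Fin.ext ?_
          rw [← Nat.div_add_mod b'.val D, ← Nat.div_add_mod b₂.val D, hb', hb₂, ← hcb, ← hcb₂, hcc]
        rw [hcc, hll, hbb]
      · simp at hl₂
      · simp at hl₂
    · simp at hl
    · simp at hl

/-- At time `2 * T + 1`, all nodes that are connected to the hub are also connected to `W`
sources. -/
theorem le_relDeg_of_edge_hub (hW : W ≤ r) {T : ℕ} (u : Vertex N h M (2 ^ D) r)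
    (hu : Edge N h M D r W (2 * T + 1) u hub) : W ≤ relDeg (Edge N h M D r W (2 * T + 1)) u := by
  rcases hu with _ | _ | _ | _ | _ | _ | ⟨l, a, hl, hk⟩
  have hinj : Function.Injective fun j : Fin W =>
      (source (Fin.castLE hW j) : Vertex N h M (2 ^ D) r) := by
    intro i j hij
    simpa using hij
  have hcard : (Finset.univ.image fun j : Fin W =>
      (source (Fin.castLE hW j) : Vertex N h M (2 ^ D) r)).card = W := by
    rw [Finset.card_image_of_injective _ hinj, Finset.card_univ, Fintype.card_fin]
  refine hcard.symm.le.trans (Finset.card_le_card fun v hv => ?_)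
  simp only [Finset.mem_image, Finset.mem_univ, true_and] at hv
  obtain ⟨j, rfl⟩ := hv
  simp only [Finset.mem_filter, Finset.mem_univ, true_and]
  -- By parity, `2 * a ≤ 2 * T + 1` already implies `2 * a + 1 ≤ 2 * T + 1`.
  exact .nodeSource l a _ hl (by omega) (by simp)

theorem edge_leaf_iff (u : Vertex N h M (2 ^ D) r) (i : Fin N) :
    Edge N h M D r W k u (leaf i) ↔ u = hub :=
  ⟨fun hu => by cases hu; rfl, fun hu => hu ▸ .hubLeaf i⟩

/-- An edge of the final graph is determined by its source, or by its target, or it is one of the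
edges that leave height `0`. -/
theorem card_edges_le (hM : 0 < M) :
    (Finset.univ.filter fun p : Vertex N h M (2 ^ D) r × Vertex N h M (2 ^ D) r =>
      Edge N h M D r W k p.1 p.2).card ≤
      2 * Fintype.card (Vertex N h M (2 ^ D) r) + M * (W + 1) := by
  let V := Vertex N h M (2 ^ D) r
  let f : V → V × V := fun u => (u, match u with
    | mid l b _ => node l.castSucc b
    | _ => node (Fin.last h) ⟨0, hM⟩)
  let g : V → V × V := fun v => (match v with
    | mid l b _ => node l.succ ⟨b / D, (Nat.div_le_self _ _).trans_lt b.isLt⟩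
    | _ => hub, v)
  let s : Fin M × Option (Fin W) → V × V := fun p => (node 0 p.1, match p.2 with
    | none => hub
    -- The value `hub` for `j ≥ r` is a dummy; superfluous pairs only weaken the upper bound.
    | some j => if hj : j.val < r then source ⟨j, hj⟩ else hub)
  have hsub : (Finset.univ.filter fun p : V × V => Edge N h M D r W k p.1 p.2) ⊆
      (Finset.univ.image f ∪ Finset.univ.image g) ∪ Finset.univ.image s := by
    rintro ⟨u, v⟩ huv
    simp only [Finset.mem_filter, Finset.mem_univ, true_and] at huv
    simp only [Finset.mem_union, Finset.mem_image, Finset.mem_univ, true_and]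
    cases huv with
    | hubLeaf i => exact Or.inl (Or.inr ⟨leaf i, rfl⟩)
    | leafRoot i l a hl ha =>
      rw [show l = Fin.last h from Fin.ext hl, show a = ⟨0, hM⟩ from Fin.ext ha]
      exact Or.inl (Or.inl ⟨leaf i, rfl⟩)
    | sourceRoot j l a hl ha =>
      rw [show l = Fin.last h from Fin.ext hl, show a = ⟨0, hM⟩ from Fin.ext ha]
      exact Or.inl (Or.inl ⟨source j, rfl⟩)
    | nodeRoot l' a' l a hl ha =>
      rw [show l = Fin.last h from Fin.ext hl, show a = ⟨0, hM⟩ from Fin.ext ha]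
      exact Or.inl (Or.inl ⟨node l' a', rfl⟩)
    | midNode l b c l' hl =>
      rw [show l' = l.castSucc from Fin.ext hl]
      exact Or.inl (Or.inl ⟨mid l b c, rfl⟩)
    | nodeMid l' a l b c hl hb hc hcb h' =>
      rw [show l' = l.succ from Fin.ext hl,
        show a = ⟨b / D, (Nat.div_le_self _ _).trans_lt b.isLt⟩ from Fin.ext hb.symm]
      exact Or.inl (Or.inr ⟨mid l b c, rfl⟩)
    | nodeHub l a hl h' =>
      rw [show l = 0 from Fin.ext hl]
      exact Or.inr ⟨(a, none), rfl⟩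
    | nodeSource l a j hl h' hj =>
      rw [show l = 0 from Fin.ext hl]
      exact Or.inr ⟨(a, some ⟨j, hj⟩), by simp [s]⟩
  refine (Finset.card_le_card hsub).trans ((Finset.card_union_le _ _).trans ?_)
  have h1 := Finset.card_union_le (Finset.univ.image f) (Finset.univ.image g)
  have h2 : (Finset.univ.image f).card ≤ Fintype.card V := Finset.card_image_le
  have h3 : (Finset.univ.image g).card ≤ Fintype.card V := Finset.card_image_le
  have h4 : (Finset.univ.image s).card ≤ Fintype.card (Fin M × Option (Fin W)) :=
    Finset.card_image_le
  rw [Fintype.card_prod, Fintype.card_option, Fintype.card_fin, Fintype.card_fin] at h4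
  change _ ≤ 2 * Fintype.card V + _
  omega

end Edge

theorem NoDangling.le_card {n : ℕ} {G : Graph n} (hG : NoDangling G) : n ≤ G.card := by
  have : (Finset.univ : Finset (Fin n)) ⊆ G.image Prod.fst := by
    intro u _
    obtain ⟨v, hv⟩ := Finset.card_pos.1 (hG u)
    exact Finset.mem_image.2 ⟨(u, v), by simpa using hv, rfl⟩
  simpa using (Finset.card_le_card this).trans Finset.card_image_le

open scoped Classical in
theorem card_graphOf {V : Type*} [Fintype V] {n : ℕ} (e : V ≃ Fin n) (E : V → V → Prop) :
    (graphOf e E).card = (Finset.univ.filter fun p : V × V => E p.1 p.2).card := by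
  rw [← Finset.card_map (e.prodCongr e).toEmbedding]
  congr 1
  ext ⟨u, v⟩
  obtain ⟨u, rfl⟩ := e.surjective u
  obtain ⟨v, rfl⟩ := e.surjective v
  simp [mem_graphOf]

/-! ### PageRank of the leaves at even and odd times -/

open Vertex

namespace Edge

variable {N h D r W : ℕ} {ε : ℝ}

/-- The mass that reaches the node `T / D ^ l` at height `l` at time `2 * T`. -/
theorem le_stationary_node (h0 : 0 < ε) (h1 : ε < 1) (hD : 0 < D) {T : ℕ} (hT : T < D ^ h)
    {ρ : Vertex N h (D ^ h) (2 ^ D) r → ℝ}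
    (hρ : IsStationary ε (Edge N h (D ^ h) D r W (2 * T)) ρ) (i : ℕ) (l : Fin (h + 1))
    (hl : l.val + i = h) :
    ((1 - ε) ^ 2 / 2) ^ i * ((1 - ε) * ε * r / Fintype.card (Vertex N h (D ^ h) (2 ^ D) r)) ≤
      ρ (node l ⟨T / D ^ l.val, (Nat.div_le_self _ _).trans_lt hT⟩) := by
  have hM : 0 < D ^ h := by omega
  have hε : 0 < 1 - ε := by linarith
  induction i generalizing l with
  | zero =>
    -- At the root, it is enough to count the jump mass of the `r` sources, each of which has the
    -- root as its only out-neighbour.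
    have h2 := hρ.sum_flow_le h0 h1
      (node l ⟨T / D ^ l.val, (Nat.div_le_self _ _).trans_lt hT⟩)
      (Finset.univ.map ⟨source, fun i j hij => by cases hij; rfl⟩) (by
        intro u hu
        obtain ⟨j, -, rfl⟩ := Finset.mem_map.1 hu
        refine .sourceRoot _ _ _ (by omega) ?_
        rw [show l.val = h by omega]
        exact Nat.div_eq_of_lt hT)
    rw [Finset.sum_map] at h2
    refine le_trans ?_ h2
    have h3 : ∀ j : Fin r, (1 - ε) * (ε / Fintype.card (Vertex N h (D ^ h) (2 ^ D) r)) ≤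
        (1 - ε) / relDeg (Edge N h (D ^ h) D r W (2 * T)) (source j) * ρ (source j) := by
      intro j
      rw [relDeg_source hM, Nat.cast_one, div_one]
      exact mul_le_mul_of_nonneg_left (hρ.jump_le h1 _) hε.le
    refine le_trans (le_of_eq ?_) (Finset.sum_le_sum fun j _ => h3 j)
    rw [Finset.sum_const, Finset.card_univ, Fintype.card_fin, nsmul_eq_mul]
    ring
  | succ i ih =>
    have h2 := ih ⟨l.val + 1, by omega⟩ (by simp only; omega)
    let l' : Fin h := ⟨l.val, by omega⟩
    let a : Fin (D ^ h) := ⟨T / D ^ (l.val + 1), (Nat.div_le_self _ _).trans_lt hT⟩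
    let b : Fin (D ^ h) := ⟨T / D ^ l.val, (Nat.div_le_self _ _).trans_lt hT⟩
    have hb : b.val / D = a.val := by
      show T / D ^ l.val / D = T / D ^ (l.val + 1)
      rw [pow_succ, Nat.div_div_eq_div_mul]
    have hcard := card_routes (N := N) (r := r) hD l' b
    have h3 := hρ.two_step_le h0 h1 (x := node l'.succ a) (y := node l b) (routes N (D ^ h) r D l' b)
      (Finset.card_pos.1 (by rw [hcard]; positivity)) (by
        intro z hz
        simp only [routes, Finset.mem_image, Finset.mem_filter, Finset.mem_univ, true_and] at hz
        obtain ⟨c, ⟨hc, hcb⟩, rfl⟩ := hz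
        exact .nodeMid _ _ _ _ _ rfl hb hc hcb
          (Nat.mul_le_mul_left _ (Nat.div_mul_le_self T _)))
      (by
        intro z hz
        simp only [routes, Finset.mem_image, Finset.mem_filter, Finset.mem_univ, true_and] at hz
        obtain ⟨c, -, rfl⟩ := hz
        exact .midNode _ _ _ _ rfl)
      (by
        intro z hz
        simp only [routes, Finset.mem_image, Finset.mem_filter, Finset.mem_univ, true_and] at hz
        obtain ⟨c, -, rfl⟩ := hz
        exact relDeg_mid _ _ _)
      (relDeg_node_succ_le hD l' a b rfl rfl)
    refine le_trans ?_ h3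
    rw [pow_succ', mul_assoc]
    exact mul_le_mul_of_nonneg_left h2 (by positivity)

/-- At time `2 * T`, the leaves have a large PageRank. -/
theorem le_stationary_leaf (h0 : 0 < ε) (h1 : ε < 1) (hD : 0 < D) (hN : 0 < N)
    (hr : 14 * N ≤ (1 - ε) ^ 3 * ((1 - ε) ^ 2 / 2) ^ h * r) {T : ℕ} (hT : T < D ^ h)
    {ρ : Vertex N h (D ^ h) (2 ^ D) r → ℝ}
    (hρ : IsStationary ε (Edge N h (D ^ h) D r W (2 * T)) ρ) (i : Fin N) :
    8 * (ε / Fintype.card (Vertex N h (D ^ h) (2 ^ D) r)) ≤ ρ (leaf i) := by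
  have hε : 0 < 1 - ε := by linarith
  have hn : 0 < Fintype.card (Vertex N h (D ^ h) (2 ^ D) r) := Fintype.card_pos_iff.2 ⟨hub⟩
  set n := Fintype.card (Vertex N h (D ^ h) (2 ^ D) r)
  have hn' : (0 : ℝ) < n := by exact_mod_cast hn
  have hN' : (0 : ℝ) < N := by exact_mod_cast hN
  have h2 := le_stationary_node h0 h1 hD hT hρ h 0 (by simp)
  set a : Fin (D ^ h) := ⟨T / D ^ (0 : Fin (h + 1)).val, (Nat.div_le_self _ _).trans_lt hT⟩ with ha
  have haT : a.val = T := by simp [ha]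
  have h3 := hρ.flow_le h0 h1 (Edge.nodeHub 0 a rfl (by omega))
  have hdeg : (relDeg (Edge N h (D ^ h) D r W (2 * T)) (node 0 a) : ℝ) ≤ 2 := by
    exact_mod_cast relDeg_node_zero_le a haT
  have hdeg0 : (0 : ℝ) < relDeg (Edge N h (D ^ h) D r W (2 * T)) (node 0 a) := by
    exact_mod_cast Finset.card_pos.2 ⟨hub, by simpa using Edge.nodeHub 0 a rfl (by omega)⟩
  have h4 : (1 - ε) / 2 * (((1 - ε) ^ 2 / 2) ^ h * ((1 - ε) * ε * r / n)) ≤ ρ hub :=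
    le_trans (mul_le_mul (div_le_div_of_nonneg_left hε.le hdeg0 hdeg) h2 (by positivity)
      (by positivity)) h3
  rw [hρ.eq_of_forall_iff (fun u => edge_leaf_iff u i), relDeg_hub]
  have h5 : (1 - ε) / N * ((1 - ε) / 2 * (((1 - ε) ^ 2 / 2) ^ h * ((1 - ε) * ε * r / n))) ≤
      (1 - ε) / N * ρ hub := mul_le_mul_of_nonneg_left h4 (by positivity)
  -- The leaf's own jump mass supplies the eighth `ε / n`. The constant 14 in `hr` is 7 times the
  -- degree bound 2, and `(1 - ε) ^ 3` pays for the edges source-root, node-hub and hub-leaf.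
  have h6 : 7 * (ε / n) ≤
      (1 - ε) / N * ((1 - ε) / 2 * (((1 - ε) ^ 2 / 2) ^ h * ((1 - ε) * ε * r / n))) := by
    have : (1 - ε) / N * ((1 - ε) / 2 * (((1 - ε) ^ 2 / 2) ^ h * ((1 - ε) * ε * r / n))) =
        ε / n / (2 * N) * ((1 - ε) ^ 3 * ((1 - ε) ^ 2 / 2) ^ h * r) := by
      field_simp
    rw [this]
    calc 7 * (ε / n) = ε / n / (2 * N) * (14 * N) := by field_simp; norm_num
      _ ≤ _ := mul_le_mul_of_nonneg_left hr (by positivity)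
  linarith

/-- At time `2 * T + 1`, the leaves have a small PageRank. -/
theorem stationary_leaf_le (h0 : 0 < ε) (h1 : ε < 1) (hN : 2 ≤ N) (hW : W ≤ r)
    (hn : 2 * (Fintype.card (Vertex N h (D ^ h) (2 ^ D) r) : ℝ) ≤ ε * (W * N)) {T : ℕ}
    {ρ : Vertex N h (D ^ h) (2 ^ D) r → ℝ}
    (hρ : IsStationary ε (Edge N h (D ^ h) D r W (2 * T + 1)) ρ) (i : Fin N) :
    ρ (leaf i) ≤ 2 * (ε / Fintype.card (Vertex N h (D ^ h) (2 ^ D) r)) := by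
  have hε : 0 < 1 - ε := by linarith
  have hn0 : 0 < Fintype.card (Vertex N h (D ^ h) (2 ^ D) r) := Fintype.card_pos_iff.2 ⟨hub⟩
  set n := Fintype.card (Vertex N h (D ^ h) (2 ^ D) r)
  have hn' : (0 : ℝ) < n := by exact_mod_cast hn0
  have hN' : (2 : ℝ) ≤ N := by exact_mod_cast hN
  have hW0 : 0 < W := by
    rcases Nat.eq_zero_or_pos W with rfl | h
    · simp at hn
      linarith
    · exact h
  have hW' : (0 : ℝ) < W := by exact_mod_cast hW0
  have h2 := hρ.le_of_forall_le_relDeg h1 hW0 hub (le_relDeg_of_edge_hub hW)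
  rw [hρ.eq_of_forall_iff (fun u => edge_leaf_iff u i), relDeg_hub]
  have h3 : (1 - ε) / N * ρ hub ≤ 1 / N * (ε / n + 1 / W) := by
    refine mul_le_mul ?_ (h2.trans ?_) (hρ.nonneg _) (by positivity)
    · gcongr
      linarith
    · have : 1 / (W : ℝ) * (1 - ε) ≤ 1 / W * 1 := by gcongr; linarith
      rw [mul_one] at this
      change ε / n + _ ≤ _
      linarith
  -- The hub's jump mass and the diluted tree flow each add at most half of `ε / n` to a leaf.
  have h4 : 1 / (N : ℝ) * (ε / n) ≤ 1 / 2 * (ε / n) := by gcongr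
  have h5 : 1 / (N : ℝ) * (1 / W) ≤ 1 / 2 * (ε / n) := by
    rw [div_mul_div_comm, div_mul_div_comm, div_le_div_iff₀ (by positivity) (by positivity)]
    linarith
  rw [mul_add] at h3
  linarith

open scoped Classical in
theorem exists_list_fluctuates {n : ℕ} (h0 : 0 < ε) (h1 : ε < 1) (hD : 0 < D) (hN : 2 ≤ N)
    (hW : W ≤ r) (hcard : Fintype.card (Vertex N h (D ^ h) (2 ^ D) r) = n)
    (hr : 14 * N ≤ (1 - ε) ^ 3 * ((1 - ε) ^ 2 / 2) ^ h * r) (hn : 2 * (n : ℝ) ≤ ε * (W * N)) :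
    ∃ σ : List (Fin n × Fin n), σ.Nodup ∧ n ≤ σ.length ∧
      σ.length ≤ 2 * n + D ^ h * (W + 1) ∧ Fluctuates ε N (2 * D ^ h - 1) σ := by
  have hM : 0 < D ^ h := by positivity
  have e : Vertex N h (D ^ h) (2 ^ D) r ≃ Fin n := Fintype.equivFinOfCardEq hcard
  let F : ℕ → Graph n := fun k => graphOf e (Edge N h (D ^ h) D r W k)
  have hF : Monotone F := fun k k' hk p hp => by
    simp only [F, graphOf, Finset.mem_filter, Finset.mem_univ, true_and] at hp ⊢
    exact hp.mono hk
  have hG : ∀ k, NoDangling (F k) := fun k =>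
    noDangling_graphOf e (exists_edge (by omega) hM k)
  let L : Finset (Vertex N h (D ^ h) (2 ^ D) r) :=
    Finset.univ.map ⟨leaf, fun i j hij => by cases hij; rfl⟩
  obtain ⟨σ, hσ, hlen, hfl⟩ := exists_fluctuates (ε := ε) F hF (2 * D ^ h - 1)
    (L.map e.toEmbedding) hG (by
      intro k hk
      refine farApart_graphOf e L fun ρ ρ' hρ hρ' v hv => ?_
      obtain ⟨i, -, rfl⟩ := Finset.mem_map.1 hv
      change 4 * ρ (leaf i) ≤ ρ' (leaf i) ∨ 4 * ρ' (leaf i) ≤ ρ (leaf i)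
      -- The leaves fall from `2 * T` to `2 * T + 1` and rise from there to `2 * (T + 1)`. Stopping
      -- after `2 * D ^ h - 1` changes keeps every bottom node used below `D ^ h`.
      rcases Nat.even_or_odd' k with ⟨T, rfl | rfl⟩
      · have a := le_stationary_leaf h0 h1 hD (by omega) hr (T := T) (by omega) hρ i
        have b := stationary_leaf_le h0 h1 hN hW (by rw [hcard]; exact hn) hρ' i
        right
        linarith
      · have a := le_stationary_leaf h0 h1 hD (by omega) hr (T := T + 1) (by omega) hρ' i
        have b := stationary_leaf_le h0 h1 hN hW (by rw [hcard]; exact hn) hρ i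
        left
        linarith)
  refine ⟨σ, hσ, ?_, ?_, ?_⟩
  · rw [hlen]
    exact (hG _).le_card
  · rw [hlen, card_graphOf, ← hcard]
    exact card_edges_le hM
  · simpa [L] using hfl

end Edge

/-! ### Choice of the parameters -/

theorem exists_list_fluctuates_of_pow_le {ε : ℝ} (h0 : 0 < ε) (h1 : ε < 1) {B D h n : ℕ}
    (hB1 : 1 ≤ B * ((1 - ε) ^ 2 / 2)) (hB2 : 4 ≤ ε * B) (hD : 0 < D)
    (hn : D ^ h * B ^ (h + D + 9) ≤ n) :
    ∃ (σ : List (Fin n × Fin n)) (N m : ℕ), σ.Nodup ∧ n ≤ σ.length ∧ σ.length ≤ 4 * n ∧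
      Fluctuates ε N m σ ∧ n * D ^ h ≤ 2 * B ^ (h + 7) * (m * N) := by
  have hε : 0 < 1 - ε := by linarith
  have hB : 2 ≤ B := by
    have : (2 : ℝ) ≤ B := by nlinarith [(Nat.cast_nonneg B : (0 : ℝ) ≤ B)]
    exact_mod_cast this
  have hP : 0 < D ^ h := by positivity
  have hpow : ∀ i j : ℕ, i ≤ j → B ^ i ≤ B ^ j := fun i j hij =>
    Nat.pow_le_pow_right (by omega) hij
  have hXn : B ^ (h + D + 9) ≤ n := (Nat.le_mul_of_pos_left _ hP).trans hn
  have hmul : ∀ i j : ℕ, 2 ^ j * B ^ i ≤ B ^ (i + j) := fun i j => by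
    rw [pow_add, mul_comm]
    exact Nat.mul_le_mul_left _ (Nat.pow_le_pow_left hB j)
  -- The power `B ^ (h + 2)` covers the loss along the tree and the factor `(1 - ε) ^ 3`; the other
  -- `B ^ 5 ≥ 28` covers the constants.
  set N := n / B ^ (h + 7) with hNdef
  have hB7 : 0 < B ^ (h + 7) := by positivity
  have hNle : N * B ^ (h + 7) ≤ n := Nat.div_mul_le_self _ _
  have hN2 : 2 ≤ N := by
    rw [hNdef, Nat.le_div_iff_mul_le hB7]
    exact (hmul (h + 7) 1).trans ((hpow _ _ (by omega)).trans hXn)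
  have hnN : n ≤ 2 * B ^ (h + 7) * N := by
    have := Nat.lt_div_mul_add (a := n) hB7
    rw [← hNdef] at this
    nlinarith
  have hN4 : 4 * N ≤ n := by
    have : 4 ≤ B ^ (h + 7) :=
      calc 4 = 2 ^ 2 * B ^ 0 := by simp
        _ ≤ B ^ (0 + 2) := hmul 0 2
        _ ≤ _ := hpow _ _ (by omega)
    nlinarith
  have hW1 : 2 * B ^ (h + 8) ≤ B ^ (h + D + 9) := (hmul (h + 8) 1).trans (hpow _ _ (by omega))
  have hW0 : 0 < B ^ (h + 8) := by positivity
  have htree : 4 * (1 + (h + 1) * D ^ h + h * (D ^ h * 2 ^ D)) ≤ n := by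
    have a : h + 1 ≤ 2 ^ h := Nat.lt_two_pow_self
    have b : 1 ≤ 2 ^ D := Nat.one_le_two_pow
    have c : 1 + (h + 1) * D ^ h + h * (D ^ h * 2 ^ D) ≤ 2 * (h + 1) * (D ^ h * 2 ^ D) := by
      nlinarith [Nat.mul_le_mul_left (D ^ h) b, Nat.zero_le (h * (D ^ h * 2 ^ D)),
        Nat.mul_le_mul_left (h * D ^ h) b]
    calc _ ≤ 4 * (2 * 2 ^ h * (D ^ h * 2 ^ D)) := by
          refine Nat.mul_le_mul_left _ (c.trans ?_)
          gcongr
      _ = D ^ h * 2 ^ (h + D + 3) := by ring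
      _ ≤ D ^ h * B ^ (h + D + 9) := by
          refine Nat.mul_le_mul_left _ ((Nat.pow_le_pow_left hB _).trans (hpow _ _ (by omega)))
      _ ≤ n := hn
  -- The tree and the leaves take at most a quarter of the vertices each. All remaining vertices, at
  -- least half, become sources.
  obtain ⟨r, hr⟩ := Nat.exists_eq_add_of_le
    (show 1 + (N + ((h + 1) * D ^ h + h * (D ^ h * 2 ^ D))) ≤ n by omega)
  have hr2 : n ≤ 2 * r := by omega
  have hcard : Fintype.card (Vertex N h (D ^ h) (2 ^ D) r) = n := by
    rw [Vertex.card_eq, hr]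
    ring
  -- One more factor `B` in `W` than in `n / N` gives the dilution, as `ε * B ≥ 4`.
  obtain ⟨σ, h2, h3, h4, h5⟩ := Edge.exists_list_fluctuates (W := B ^ (h + 8)) h0 h1 hD hN2
    (by omega) hcard (by
      have hB' : (0 : ℝ) < B := by positivity
      have e1 : 1 / (B : ℝ) ≤ (1 - ε) ^ 2 / 2 := by
        rw [div_le_iff₀ hB', mul_comm]
        exact hB1
      have e2 : (1 / (B : ℝ)) ^ 2 ≤ (1 - ε) ^ 3 :=
        calc (1 / (B : ℝ)) ^ 2 ≤ ((1 - ε) ^ 2 / 2) ^ 2 := by gcongr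
          _ = (1 - ε) ^ 3 * ((1 - ε) / 4) := by ring
          _ ≤ (1 - ε) ^ 3 * 1 := by gcongr; linarith
          _ = _ := mul_one _
      have e3 : (N : ℝ) * B ^ (h + 7) ≤ 2 * r := by exact_mod_cast hNle.trans hr2
      have e4 : (28 : ℝ) ≤ B ^ 5 := by
        have : 28 ≤ B ^ 5 := (by norm_num : 28 ≤ 2 ^ 5).trans (Nat.pow_le_pow_left hB 5)
        exact_mod_cast this
      calc 14 * (N : ℝ) = (1 / B) ^ 2 * (1 / B) ^ h * (28 * (N * B ^ (h + 2)) / 2) := by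
            rw [one_div, inv_pow, inv_pow, pow_add]
            field_simp
            norm_num
        _ ≤ (1 / B) ^ 2 * (1 / B) ^ h * (B ^ 5 * (N * B ^ (h + 2)) / 2) := by gcongr
        _ = (1 / B) ^ 2 * (1 / B) ^ h * ((N * B ^ (h + 7)) / 2) := by ring
        _ ≤ (1 / B) ^ 2 * (1 / B) ^ h * ((2 * r) / 2) := by gcongr
        _ ≤ (1 - ε) ^ 3 * ((1 - ε) ^ 2 / 2) ^ h * ((2 * r) / 2) := by gcongr
        _ = _ := by ring) (by
      have e : (n : ℝ) ≤ 2 * B ^ (h + 7) * N := by exact_mod_cast hnN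
      have e' : (0 : ℝ) ≤ B ^ (h + 7) * N := by positivity
      rw [Nat.cast_pow, show ε * ((B : ℝ) ^ (h + 8) * N) = ε * B * (B ^ (h + 7) * N) by ring]
      nlinarith [mul_le_mul_of_nonneg_right hB2 e'])
  refine ⟨σ, N, 2 * D ^ h - 1, h2, h3, h4.trans ?_, h5, ?_⟩
  · have : D ^ h * (B ^ (h + 8) + 1) ≤ D ^ h * B ^ (h + D + 9) :=
      Nat.mul_le_mul_left _ (by omega)
    omega
  · calc n * D ^ h ≤ 2 * B ^ (h + 7) * N * (2 * D ^ h - 1) :=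
          Nat.mul_le_mul hnN (by omega)
      _ = _ := by ring

/-- A list of edges along which the PageRank fluctuates `n ^ (2 - 1 / (s + 1))` times in total. -/
def IsHard (ε : ℝ) {n : ℕ} (σ : List (Fin n × Fin n)) (s : ℕ) : Prop :=
  σ.Nodup ∧ n ≤ σ.length ∧ σ.length ≤ 4 * n ∧ ∃ N m : ℕ, Fluctuates ε N m σ ∧
    (n : ℝ) ^ (2 - 1 / ((s : ℝ) + 1)) ≤ m * N

theorem IsHard.anti {ε : ℝ} {n : ℕ} (hn : 1 ≤ n) {σ : List (Fin n × Fin n)} {s t : ℕ} (hst : s ≤ t)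
    (h : IsHard ε σ t) : IsHard ε σ s := by
  obtain ⟨h1, h2, h3, N, m, h4, h5⟩ := h
  refine ⟨h1, h2, h3, N, m, h4, le_trans ?_ h5⟩
  refine Real.rpow_le_rpow_of_exponent_le (by exact_mod_cast hn) ?_
  gcongr

/-- For `D = B ^ d`, the number `D ^ h` of phases is the `d`-th power of the loss `B ^ h`. The
tallest trees that fit have `B ^ ((d + 1) * h)` equal to `n` up to a constant factor, so the losses
are powers of `n` of order `1 / d`. -/
theorem eventually_exists_isHard {ε : ℝ} (h0 : 0 < ε) (h1 : ε < 1) (s : ℕ) :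
    ∀ᶠ n : ℕ in atTop, ∃ σ : List (Fin n × Fin n), IsHard ε σ s := by
  have hε : 0 < 1 - ε := by linarith
  obtain ⟨B, hB⟩ := exists_nat_ge (max (2 / (1 - ε) ^ 2) (4 / ε))
  have hB1 : 1 ≤ B * ((1 - ε) ^ 2 / 2) := by
    have := (le_max_left _ _).trans hB
    rw [div_le_iff₀ (by positivity)] at this
    linarith
  have hB2 : 4 ≤ ε * B := by
    have := (le_max_right _ _).trans hB
    rw [div_le_iff₀ h0] at this
    linarith
  have hBR : (2 : ℝ) ≤ B := by nlinarith [(Nat.cast_nonneg B : (0 : ℝ) ≤ B)]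
  have hB0 : 2 ≤ B := by exact_mod_cast hBR
  set d := 4 * (s + 1) with hd
  set D := B ^ d with hD
  set K := D + 9 with hK
  -- `H` is a minimum height. It lets the gain of `δ * d = 4` in the exponent per level absorb the
  -- bounded overhead from `K`, rounding the logarithm, and constants.
  set H := 8 + (d + 1) * (K + 1) with hH
  have hQ : 1 < B ^ (d + 1) := Nat.one_lt_pow (by omega) (by omega)
  filter_upwards [eventually_ge_atTop ((B ^ (d + 1)) ^ (H + K))] with n hn
  have hn0 : n ≠ 0 := by
    rintro rfl
    have : 0 < (B ^ (d + 1)) ^ (H + K) := by positivity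
    omega
  -- The tree has height `H + h`, which is `K` less than the logarithm of `n`; this leaves room for
  -- the factor `B ^ K`.
  obtain ⟨h, hh⟩ := Nat.exists_eq_add_of_le (Nat.le_log_of_pow_le hQ hn)
  have hlow := Nat.pow_log_le_self (B ^ (d + 1)) hn0
  have hup := Nat.lt_pow_succ_log_self hQ n
  obtain ⟨σ, N, m, a1, a2, a3, a4, a5⟩ := exists_list_fluctuates_of_pow_le (D := D) (h := H + h)
    h0 h1 hB1 hB2 (by positivity) (le_trans (by
      rw [hD, ← pow_mul, ← pow_mul, ← pow_add]
      refine Nat.pow_le_pow_right (by omega) ?_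
      rw [hh, ← hD]
      nlinarith [Nat.zero_le (d * K)]) hlow)
  refine ⟨σ, a1, a2, a3, N, m, a4, ?_⟩
  have hnR : (0 : ℝ) < n := by positivity
  have hB' : (0 : ℝ) < B := by positivity
  have hs : (0 : ℝ) < (s : ℝ) + 1 := by positivity
  have b5 : (n : ℝ) * B ^ (d * (H + h)) ≤ 2 * B ^ (H + h + 7) * (m * N) := by
    rw [hD, ← pow_mul] at a5
    exact_mod_cast a5
  have hup' : (n : ℝ) ≤ (B : ℝ) ^ (((d : ℝ) + 1) * (H + K + h + 1)) := by
    rw [hh, ← pow_mul] at hup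
    have : (n : ℝ) ≤ (B : ℝ) ^ ((d + 1) * (H + K + h + 1)) := by exact_mod_cast hup.le
    rw [← Real.rpow_natCast] at this
    push_cast at this
    exact this
  set δ : ℝ := 1 / ((s : ℝ) + 1) with hδ
  have hδ1 : δ ≤ 1 := by
    rw [hδ, div_le_one hs]
    linarith [(Nat.cast_nonneg s : (0 : ℝ) ≤ s)]
  have hδ0 : 0 ≤ δ := by positivity
  have hδd : δ * d = 4 := by
    rw [hδ, hd]
    push_cast
    field_simp
  have c1 : (n : ℝ) ^ (1 - δ) ≤ (B : ℝ) ^ ((d : ℝ) * (H + h) - (H + h) - 8) := by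
    refine (Real.rpow_le_rpow hnR.le hup' (by linarith)).trans ?_
    rw [← Real.rpow_mul hB'.le]
    refine Real.rpow_le_rpow_of_exponent_le (by linarith) ?_
    have hHR : (H : ℝ) = 8 + (d + 1) * (K + 1) := by rw [hH]; push_cast; ring
    have e : ((d : ℝ) + 1) * (H + K + h + 1) * (1 - δ) =
        d * (H + h) - (δ * d) * (H + h) + (H + h) * (1 - δ) + (d + 1) * (K + 1) * (1 - δ) := by ring
    rw [e, hδd]
    have e2 : ((d : ℝ) + 1) * (K + 1) * (1 - δ) ≤ (d + 1) * (K + 1) :=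
      mul_le_of_le_one_right (by positivity) (by linarith)
    have e3 : ((H : ℝ) + h) * (1 - δ) ≤ H + h :=
      mul_le_of_le_one_right (by positivity) (by linarith)
    have e4 : (0 : ℝ) ≤ h := by positivity
    have e5 : (0 : ℝ) ≤ H := by positivity
    linarith
  have c2 : (B : ℝ) ^ ((d : ℝ) * (H + h) - (H + h) - 8) * B ^ (H + h + 8) =
      B ^ (d * (H + h)) := by
    rw [← Real.rpow_natCast, ← Real.rpow_natCast, ← Real.rpow_add hB']
    push_cast
    congr 1
    ring
  have c3 : (n : ℝ) ^ (2 - δ) = n * n ^ (1 - δ) := by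
    rw [show 2 - δ = 1 + (1 - δ) by ring, Real.rpow_add hnR, Real.rpow_one]
  rw [c3]
  have hpos : (0 : ℝ) < B ^ (H + h + 8) := by positivity
  refine le_of_mul_le_mul_right ?_ hpos
  calc (n : ℝ) * n ^ (1 - δ) * B ^ (H + h + 8)
      ≤ n * B ^ ((d : ℝ) * (H + h) - (H + h) - 8) * B ^ (H + h + 8) := by gcongr
    _ = n * B ^ (d * (H + h)) := by rw [mul_assoc, c2]
    _ ≤ 2 * B ^ (H + h + 7) * (m * N) := b5
    _ ≤ B * B ^ (H + h + 7) * (m * N) := by gcongr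
    _ = _ := by ring

/-! ### One list for all exponents -/

open scoped Classical in
/-- An edge list that is as hard as possible. -/
noncomputable def hardList (ε : ℝ) (n : ℕ) : List (Fin n × Fin n) :=
  let s := Nat.findGreatest (fun s => ∃ σ : List (Fin n × Fin n), IsHard ε σ s) n
  if h : ∃ σ : List (Fin n × Fin n), IsHard ε σ s then h.choose else []

theorem nodup_hardList (ε : ℝ) (n : ℕ) : (hardList ε n).Nodup := by
  simp only [hardList]
  split_ifs with h
  · exact h.choose_spec.1
  · exact List.nodup_nil

/-- For large `n` the search bound `n` admits `s` itself, so the greatest attainable parameter is at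
least `s`, and hardness is inherited by smaller parameters. The default `[]` matters only when no
hard list exists. -/
theorem eventually_isHard_hardList {ε : ℝ} (h0 : 0 < ε) (h1 : ε < 1) (s : ℕ) :
    ∀ᶠ n : ℕ in atTop, IsHard ε (hardList ε n) s := by
  classical
  filter_upwards [eventually_exists_isHard h0 h1 s, eventually_ge_atTop s, eventually_ge_atTop 1]
    with n hn hs hn1
  have h := Nat.findGreatest_spec (P := fun s => ∃ σ : List (Fin n × Fin n), IsHard ε σ s) hs hn
  have hle : s ≤ Nat.findGreatest (fun s => ∃ σ : List (Fin n × Fin n), IsHard ε σ s) n :=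
    Nat.le_findGreatest hs hn
  refine IsHard.anti hn1 hle ?_
  have := h.choose_spec
  simp only [hardList]
  rw [dif_pos (by convert h)]
  convert this

theorem requiresTime_of_forall {ε δ : ℝ} (G : (n : ℕ) → Graph n)
    (us : (n : ℕ) → List (EdgeUpdate n))
    (h : ∀ᶠ n : ℕ in atTop, 0 < (us n).length ∧ (us n).length ≤ 4 * n ∧
      ∀ (A : Machine n) (x : A.Execution (us n)), x.Maintains ε (G n) →
        (n : ℝ) ^ (2 - δ) ≤ x.totalTime) :
    RequiresTime ε δ G us := by
  -- The factor `1 / 4` is needed only for the amortized bound, where the number of updates may be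
  -- `4 * n`.
  refine ⟨1 / 4, by norm_num, ?_⟩
  filter_upwards [h, eventually_gt_atTop 0] with n ⟨hl, hl', hn⟩ hn0 A x hx
  have h2 := hn A x hx
  have hn0' : (0 : ℝ) < n := by exact_mod_cast hn0
  have hlR : (0 : ℝ) < (us n).length := by exact_mod_cast hl
  have hlR' : ((us n).length : ℝ) ≤ 4 * n := by exact_mod_cast hl'
  have h3 : (0 : ℝ) ≤ (n : ℝ) ^ (2 - δ) := by positivity
  have h4 : (0 : ℝ) ≤ (n : ℝ) ^ (1 - δ) := by positivity
  refine ⟨by linarith, ?_⟩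
  rw [le_div_iff₀ hlR]
  calc 1 / 4 * (n : ℝ) ^ (1 - δ) * (us n).length ≤ 1 / 4 * (n : ℝ) ^ (1 - δ) * (4 * n) := by gcongr
    _ = n ^ (1 - δ) * n ^ (1 : ℝ) := by rw [Real.rpow_one]; ring
    _ = n ^ (2 - δ) := by
      rw [← Real.rpow_add hn0']
      congr 1
      ring
    _ ≤ _ := h2

end DynPageRank

/-- For each jump probability `ε` there are lists `σ n` of `Θ(n)` distinct edges on `n` vertices such
that, for every `δ > 0`, maintaining a factor 2 approximation of PageRank explicitly takes
total time `Ω(n ^ (2 - δ))` while the edges are inserted one by one into the initially empty graph,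
and also while they are deleted one by one, in the reverse order, from the graph that consists of
all of them. -/
theorem mainTheorem1 (ε : ℝ) (hε₀ : 0 < ε) (hε₁ : ε < 1) :
    ∃ σ : (n : ℕ) → List (Fin n × Fin n),
      (∀ n : ℕ, (σ n).Nodup) ∧
      (fun n : ℕ => ((σ n).length : ℝ)) =Θ[atTop] (fun n : ℕ => (n : ℝ)) ∧
      ∀ δ : ℝ, 0 < δ →
        DynPageRank.RequiresTime ε δ (fun _ => ∅)
          (fun n => (σ n).map DynPageRank.EdgeUpdate.insert) ∧
        DynPageRank.RequiresTime ε δ (fun n => (σ n).toFinset)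
          (fun n => (σ n).reverse.map DynPageRank.EdgeUpdate.delete) := by
  refine ⟨DynPageRank.hardList ε, DynPageRank.nodup_hardList ε, ⟨?_, ?_⟩, fun δ hδ => ?_⟩
  · refine IsBigO.of_bound 4 ?_
    filter_upwards [DynPageRank.eventually_isHard_hardList hε₀ hε₁ 0] with n ⟨_, _, h, _⟩
    simpa using (by exact_mod_cast h : ((DynPageRank.hardList ε n).length : ℝ) ≤ 4 * n)
  · refine IsBigO.of_bound 1 ?_
    filter_upwards [DynPageRank.eventually_isHard_hardList hε₀ hε₁ 0] with n ⟨_, h, _⟩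
    simpa using h
  · obtain ⟨s, hs⟩ := exists_nat_one_div_lt hδ
    have key : ∀ᶠ n : ℕ in atTop, 1 ≤ n ∧ n ≤ (DynPageRank.hardList ε n).length ∧
        (DynPageRank.hardList ε n).length ≤ 4 * n ∧
        ∃ N m : ℕ, DynPageRank.Fluctuates ε N m (DynPageRank.hardList ε n) ∧
          (n : ℝ) ^ (2 - δ) ≤ ((m * N : ℕ) : ℝ) := by
      filter_upwards [DynPageRank.eventually_isHard_hardList hε₀ hε₁ s, eventually_ge_atTop 1]
        with n ⟨_, h1, h2, N, m, h3, h4⟩ hn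
      refine ⟨hn, h1, h2, N, m, h3, ?_⟩
      push_cast
      refine le_trans (Real.rpow_le_rpow_of_exponent_le (by exact_mod_cast hn) ?_) h4
      linarith
    constructor
    · refine DynPageRank.requiresTime_of_forall _ _ ?_
      filter_upwards [key] with n ⟨hn, h1, h2, N, m, h3, h4⟩
      rw [List.length_map]
      exact ⟨by omega, h2, fun A x hx => h4.trans
        (by exact_mod_cast h3.le_totalTime_insert hn hε₀ hε₁ x hx)⟩
    · refine DynPageRank.requiresTime_of_forall _ _ ?_
      filter_upwards [key] with n ⟨hn, h1, h2, N, m, h3, h4⟩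
      rw [List.length_map, List.length_reverse]
      exact ⟨by omega, h2, fun A x hx => h4.trans (by
        exact_mod_cast h3.le_totalTime_delete hn hε₀ hε₁ (DynPageRank.nodup_hardList ε n) x hx)⟩
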